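/- **Setting.** Let $G$ be a (real, finite-dimensional) semisimple Lie group with Lie algebra $\mathfrak g$ and Killing form $B$, and let $P\subset G$ be a parabolic subgroup: a closed Lie subgroup whose Lie algebra is $\mathfrak p=\mathfrak g_0\oplus\dots\oplus\mathfrak g_k$ for a grading $\mathfrak g=\mathfrak g_{-k}\oplus\dots\oplus\mathfrak g_k$ of the Lie algebra $\mathfrak g$; put $\mathfrak p_+=\mathfrak g_1\oplus\dots\oplus\mathfrak g_k$. Let $(p:\mathcal G\to M,\omega)$ be a parabolic geometry of type $(G,P)$, i.e. a smooth principal $P$-bundle with a Cartan connection $\omega\in\Omega^1(\mathcal G,\mathfrak g)$: each $\omega_u:T_u\mathcal G\to\mathfrak g$ is an isomorphism, $(r^h)^*\omega=\mathrm{Ad}(h^{-1})\circ\omega$ for $h\in P$, and $\omega$ reproduces the generators of fundamental vector fields. For a smooth representation $V$ of $P$, sections of $VM=\mathcal G\times_PV$ over an open set $U\subset M$ are identified with the smooth functions $f:p^{-1}(U)\to V$ such that $f(uh)=h^{-1}\cdot f(u)$. Let $\mathcal AM=\mathcal G\times_P\mathfrak g$ be the adjoint tractor bundle, with the fibrewise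 Lie bracket $\{\ ,\ \}$ and fibrewise form $B$ induced from $\mathfrak g$, and with the subbundles $\mathcal A^0M=\mathcal G\times_P\mathfrak p$ and $\mathcal A^1M=\mathcal G\times_P\mathfrak p_+$. Let $W$ be a finite-dimensional smooth representation of $P$, and let $\bullet:\mathcal A^0M\times WM\to WM$ be induced by the infinitesimal action $\mathfrak p\times W\to W$. The fundamental derivative $D:\Gamma(VM)\to\Gamma(\mathcal A^*M\otimes VM)$ is given by $(D_sf)(u)=df_u(\omega_u^{-1}(s(u)))$, and the curved Casimir operator on $\Gamma(WM)$ is $\mathcal C=(B\otimes\mathrm{id})\circ D^2$, where $B$ contracts $\mathcal A^*M\otimes\mathcal A^*M$: fibrewise $\beta\mapsto\sum_\ell\beta(\xi^\ell,\xi_\ell)$ for $B$-dual bases $\{\xi^\ell\},\{\xi_\ell\}$ of $\mathfrak g$. An adapted frame over $U$ is a frame $\{X_i,A_r,Z^i\}$ of $\mathcal AM|_U$ with $Z^i\in\Gamma(\mathcal A^1M|_U)$, $A_r\in\Gamma(\mathcal A^0M|_U)$, $B(X_i,X_j)=B(X_i,A_r)=0$ and $B(X_i,Z^j)=\delta_i^j$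 for all $i,j,r$. **Proposition 3.3.** Let $\{X_i,A_r,Z^i\}$ be an adapted frame over an open set $U\subset M$ and let $\{Z^i,A^r,X_i\}$ be its dual frame with respect to $B$. Then all $A^r$ and the section $\sum_i\{Z^i,X_i\}$ take values in $\mathcal A^0M$, and for every $\sigma\in\Gamma(WM)$ $$\mathcal C(\sigma)|_U=-2\sum_i Z^i\bullet D_{X_i}\sigma-\Big(\sum_i\{Z^i,X_i\}\Big)\bullet\sigma+\sum_rA^r\bullet A_r\bullet\sigma .$$ -/

import Mathlib

open scoped Manifold ContDiff RightActions

noncomputable section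

namespace ParabolicGeometry

/-! ### Lie groups and their Lie algebras

All manifolds are finite dimensional, real, smooth and without boundary: a manifold of dimension `n`
is a charted space over `EuclideanSpace ℝ (Fin n)`, and `𝓡 n` is its model with corners. -/

section LieGroups

/-- The Lie algebra `𝔤 = T₁G` of a Lie group, with the bracket of left invariant vector fields. -/
abbrev LieAlg (dG : ℕ) (G : Type*) [TopologicalSpace G]
    [ChartedSpace (EuclideanSpace ℝ (Fin dG)) G] [Group G] : Type :=
  GroupLieAlgebra (𝓡 dG) G

variable {dG : ℕ} {G : Type*} [TopologicalSpace G]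
  [ChartedSpace (EuclideanSpace ℝ (Fin dG)) G] [Group G]

instance : FiniteDimensional ℝ (LieAlg dG G) :=
  inferInstanceAs (FiniteDimensional ℝ (EuclideanSpace ℝ (Fin dG)))

/-- The norm of the model space. It is used only to speak about smooth functions with values in `𝔤`
or in `Hom(𝔤, V)`, so any other norm would do as well. -/
instance : NormedAddCommGroup (LieAlg dG G) :=
  inferInstanceAs (NormedAddCommGroup (EuclideanSpace ℝ (Fin dG)))

instance : NormedSpace ℝ (LieAlg dG G) :=
  inferInstanceAs (NormedSpace ℝ (EuclideanSpace ℝ (Fin dG)))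

variable (dG) in
/-- The derivative at `1` of the conjugation `x ↦ g x g⁻¹`. -/
def conjDeriv (g : G) : LieAlg dG G →L[ℝ] LieAlg dG G :=
  (mfderiv (𝓡 dG) (𝓡 dG) (fun x : G => g * x * g⁻¹) 1 :
    TangentSpace (𝓡 dG) (1 : G) →L[ℝ] TangentSpace (𝓡 dG) (g * 1 * g⁻¹))

theorem conjDeriv_one : conjDeriv dG (1 : G) = ContinuousLinearMap.id ℝ _ := by
  have h : (fun x : G => 1 * x * 1⁻¹) = id := by ext x; simp
  unfold conjDeriv
  rw [h]
  exact mfderiv_id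

variable [LieGroup (𝓡 dG) ∞ G]

instance : LieGroup (𝓡 dG) (minSmoothness ℝ 3) G :=
  LieGroup.of_le (n := ∞) (by
    rw [minSmoothness_of_isRCLikeNormedField]
    exact ENat.LEInfty.out)

/-- Conjugation `x ↦ g x g⁻¹` is smooth. -/
theorem contMDiff_conj (g : G) :
    ContMDiff (𝓡 dG) (𝓡 dG) ∞ (fun x : G => g * x * g⁻¹) :=
  (contMDiff_const.mul contMDiff_id).mul contMDiff_const

theorem conjDeriv_mul (g h : G) :
    conjDeriv dG (g * h) = (conjDeriv dG g).comp (conjDeriv dG h) := by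
  have e : (fun x : G => g * h * x * (g * h)⁻¹)
      = (fun x : G => g * x * g⁻¹) ∘ (fun x : G => h * x * h⁻¹) := by
    ext x; simp [mul_assoc]
  have h1 : h * 1 * h⁻¹ = 1 := by simp
  unfold conjDeriv
  rw [e]
  have k : ∀ y : G, y = 1 →
      (mfderiv (𝓡 dG) (𝓡 dG) (fun x : G => g * x * g⁻¹) y :
        EuclideanSpace ℝ (Fin dG) →L[ℝ] EuclideanSpace ℝ (Fin dG)) =
      (mfderiv (𝓡 dG) (𝓡 dG) (fun x : G => g * x * g⁻¹) 1 :
        EuclideanSpace ℝ (Fin dG) →L[ℝ] EuclideanSpace ℝ (Fin dG)) := by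
    rintro _ rfl
    rfl
  refine (mfderiv_comp (I' := 𝓡 dG) (1 : G)
    ((contMDiff_conj g).mdifferentiableAt (by simp))
    ((contMDiff_conj h).mdifferentiableAt (by simp))).trans ?_
  exact congrArg (fun l : EuclideanSpace ℝ (Fin dG) →L[ℝ] EuclideanSpace ℝ (Fin dG) =>
    l.comp (conjDeriv dG h : EuclideanSpace ℝ (Fin dG) →L[ℝ] EuclideanSpace ℝ (Fin dG)))
    (k _ h1)

variable (dG G) in
/-- The adjoint representation of `G` on `𝔤`. -/
def Ad : Representation ℝ G (LieAlg dG G) where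
  toFun g := (conjDeriv dG g).toLinearMap
  map_one' := by rw [conjDeriv_one]; rfl
  map_mul' g h := by rw [conjDeriv_mul]; rfl

end LieGroups

/-! ### Parabolic subgroups -/

section Parabolic

variable {dG dP : ℕ} {G : Type*} [TopologicalSpace G]
  [ChartedSpace (EuclideanSpace ℝ (Fin dG)) G] [Group G]
  (P : Subgroup G) [ChartedSpace (EuclideanSpace ℝ (Fin dP)) P]

variable (dG dP) in
/-- The derivative `T₁P → T₁G = 𝔤` at `1` of the inclusion of a subgroup `P`. -/
def lieIncl : LieAlg dP P →L[ℝ] LieAlg dG G :=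
  (mfderiv (𝓡 dP) (𝓡 dG) (Subtype.val : P → G) 1 :
    TangentSpace (𝓡 dP) (1 : P) →L[ℝ] TangentSpace (𝓡 dG) ((1 : P) : G))

variable (dG dP) in
/-- The Lie algebra `𝔭 ⊆ 𝔤` of the subgroup `P`. -/
def lieSub : Submodule ℝ (LieAlg dG G) := LinearMap.range (lieIncl dG dP P).toLinearMap

/-- The filtration component `𝔤^i = ⨁_{j ≥ i} 𝔤_j` attached to a grading of `𝔤`. -/
def filt {L : Type*} [AddCommGroup L] [Module ℝ L] (gr : ℤ → Submodule ℝ L) (i : ℤ) :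
    Submodule ℝ L :=
  ⨆ j : ℤ, ⨆ _ : i ≤ j, gr j

theorem filt_anti {L : Type*} [AddCommGroup L] [Module ℝ L] (gr : ℤ → Submodule ℝ L) {i j : ℤ}
    (h : i ≤ j) : filt gr j ≤ filt gr i :=
  iSup_mono fun _ => iSup_mono' fun hk => ⟨h.trans hk, le_rfl⟩

/-- `P`, with its Lie group structure for the subspace topology, is a closed Lie subgroup of `G`, and
its Lie algebra is the parabolic subalgebra `𝔭 = 𝔤_0 ⊕ ⋯ ⊕ 𝔤_k` of the grading
`𝔤 = 𝔤_{-k} ⊕ ⋯ ⊕ 𝔤_k` (as `𝔤` is finite dimensional, only finitely many components of a grading are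
non-zero). Its nilradical is then `𝔭₊ = 𝔤_1 ⊕ ⋯ ⊕ 𝔤_k`. For semisimple `𝔤`, the subalgebras
of this form are exactly the parabolic ones. -/
structure IsParabolicSubgroup (gr : ℤ → Submodule ℝ (LieAlg dG G)) : Prop where
  isClosed : IsClosed (P : Set G)
  contMDiff_val : ContMDiff (𝓡 dP) (𝓡 dG) ∞ (Subtype.val : P → G)
  injective_lieIncl : Function.Injective (lieIncl dG dP P)
  lieSub_eq : lieSub dG dP P = filt gr 0

theorem IsParabolicSubgroup.filt_one_le {P : Subgroup G}
    [ChartedSpace (EuclideanSpace ℝ (Fin dP)) P] {gr : ℤ → Submodule ℝ (LieAlg dG G)}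
    (h : IsParabolicSubgroup (dP := dP) P gr) : filt gr 1 ≤ lieSub dG dP P :=
  h.lieSub_eq ▸ filt_anti gr zero_le_one

variable {P} in
/-- The representation `ρ` of the Lie group `P` is smooth. -/
def IsSmoothRep {W : Type*} [NormedAddCommGroup W] [NormedSpace ℝ W] (ρ : Representation ℝ P W) :
    Prop :=
  ∀ w : W, ContMDiff (𝓡 dP) 𝓘(ℝ, W) ∞ (fun h : P => ρ h w)

variable {P} in
/-- The infinitesimal representation `𝔭 × W → W` of a smooth representation of `P`: for
`x = lieIncl a` it is the derivative of `h ↦ ρ(h) w` at `1` in the direction `a ∈ T₁P`. The element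
`a` is unique, because the derivative of the inclusion of a Lie subgroup is injective. On
equivariant functions this is the bundle map `(s, σ) ↦ s • σ`. -/
def infAct {W : Type*} [NormedAddCommGroup W] [NormedSpace ℝ W] (ρ : Representation ℝ P W)
    (x : lieSub dG dP P) (w : W) : W :=
  mvfderiv (𝓡 dP) (fun h : P => ρ h w) 1 (Classical.choose (LinearMap.mem_range.1 x.2))

end Parabolic

/-! ### The Killing form and contractions with it -/

section Killing

variable {L : Type*} [LieRing L] [LieAlgebra ℝ L] [FiniteDimensional ℝ L]

/-- `e` and `e'` are dual to each other with respect to the Killing form. -/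
def IsKillingDual {J : Type*} [DecidableEq J] (e e' : J → L) : Prop :=
  ∀ i j, killingForm ℝ L (e i) (e' j) = if i = j then 1 else 0

variable [LieAlgebra.IsKilling ℝ L]

/-- The contraction `B ⊗ id : 𝔤* ⊗ 𝔤* ⊗ W → W` with the Killing form `B` (transported to `𝔤*`
through the isomorphism `𝔤 ≅ 𝔤*` given by `B`): `β ↦ ∑ₗ β(ξˡ, ξₗ)` for a basis `ξˡ` and its dual basis
`ξₗ`. It does not depend on the basis, see `killingContraction_eq`. -/
def killingContraction {W : Type*} [AddCommGroup W] [Module ℝ W] (β : L →ₗ[ℝ] L →ₗ[ℝ] W) : W :=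
  ∑ l, β (Module.finBasis ℝ L l)
    ((killingForm ℝ L).dualBasis (LieAlgebra.IsKilling.killingForm_nondegenerate ℝ L)
      (Module.finBasis ℝ L) l)

theorem killingContraction_eq {W : Type*} [AddCommGroup W] [Module ℝ W]
    (β : L →ₗ[ℝ] L →ₗ[ℝ] W) {J : Type*} [Fintype J] [DecidableEq J] (e : Module.Basis J ℝ L)
    (e' : J → L) (h : IsKillingDual e e') :
    killingContraction β = ∑ j, β (e j) (e' j) := by
  set B := killingForm ℝ L
  have nd : B.Nondegenerate := LieAlgebra.IsKilling.killingForm_nondegenerate ℝ L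
  have sym : LinearMap.IsSymm B := LieModule.traceForm_isSymm ℝ L L
  set f := Module.finBasis ℝ L
  set f' := B.dualBasis nd f
  have hf' : ∀ y : L, ∑ l, B (f l) y • f' l = y := fun y => by
    conv_rhs => rw [← f'.sum_repr y]
    refine Finset.sum_congr rfl fun l _ => ?_
    rw [LinearMap.BilinForm.dualBasis_repr_apply, show B (f l) y = B y (f l) from sym.eq _ _]
  have hf : ∀ x : L, ∑ j, B x (e' j) • e j = x := fun x => by
    have key : ∀ j, B x (e' j) = e.repr x j := fun j => by
      have h' : ∀ i, B (e i) (e' j) = if i = j then 1 else 0 := fun i => h i j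
      conv_lhs => rw [← e.sum_repr x, map_sum, LinearMap.sum_apply]
      simp only [map_smul, LinearMap.smul_apply, h']
      simp
    simp_rw [key]
    exact e.sum_repr x
  calc ∑ l, β (f l) (f' l) = ∑ l, ∑ j, B (f l) (e' j) • β (e j) (f' l) := by
        refine Finset.sum_congr rfl fun l _ => ?_
        conv_lhs => rw [← hf (f l)]
        simp
    _ = ∑ j, β (e j) (∑ l, B (f l) (e' j) • f' l) := by
        rw [Finset.sum_comm]
        simp
    _ = ∑ j, β (e j) (e' j) := by simp_rw [hf']

end Killing

/-! ### Parabolic geometries -/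

section Geometry

variable {dG dP dT dM : ℕ} {G : Type*} [TopologicalSpace G]
  [ChartedSpace (EuclideanSpace ℝ (Fin dG)) G] [Group G]
  {P : Subgroup G} [ChartedSpace (EuclideanSpace ℝ (Fin dP)) P]
  {T : Type*} [TopologicalSpace T] [ChartedSpace (EuclideanSpace ℝ (Fin dT)) T]
  [MulAction Pᵐᵒᵖ T]
  {M : Type*} [TopologicalSpace M] [ChartedSpace (EuclideanSpace ℝ (Fin dM)) M]

variable (dP dT dM P T M) in
/-- A smooth principal `P`-bundle `T → M`, where `P` acts on the right of the total space `T`. -/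
structure PrincipalBundle where
  /-- the projection -/
  proj : T → M
  contMDiff_action : ContMDiff ((𝓡 dT).prod (𝓡 dP)) (𝓡 dT) ∞ (fun q : T × P => q.1 <• q.2)
  /-- local triviality: over a neighbourhood `U` of each point there is an equivariant
  diffeomorphism `proj⁻¹(U) ≅ U × P` over `U` -/
  locallyTrivial : ∀ x : M, ∃ U : Set M, IsOpen U ∧ x ∈ U ∧
    ∃ Φ : PartialDiffeomorph (𝓡 dT) ((𝓡 dM).prod (𝓡 dP)) T (M × P) ∞,
      Φ.source = proj ⁻¹' U ∧ Φ.target = U ×ˢ Set.univ ∧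
      (∀ u ∈ proj ⁻¹' U, (Φ u).1 = proj u) ∧
      ∀ u ∈ proj ⁻¹' U, ∀ h : P, u <• h ∈ proj ⁻¹' U ∧ Φ (u <• h) = ((Φ u).1, (Φ u).2 * h)

variable [LieGroup (𝓡 dG) ∞ G] [IsManifold (𝓡 dT) ∞ T]

variable (dG dP dT dM P T M) in
/-- A Cartan geometry of type `(G, P)` on `M`: a principal `P`-bundle `T → M` with a Cartan
connection `ω ∈ Ω¹(T, 𝔤)`. -/
structure CartanGeometry extends PrincipalBundle dP dT dM P T M where
  /-- the Cartan connection -/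
  form : ∀ u : T, TangentSpace (𝓡 dT) u →L[ℝ] LieAlg dG G
  contMDiff_form : ContMDiff (𝓡 dT).tangent 𝓘(ℝ, LieAlg dG G) ∞
    (fun v : TangentBundle (𝓡 dT) T => form v.1 v.2)
  bijective_form : ∀ u : T, Function.Bijective (form u)
  /-- equivariance, `(r^h)^* ω = Ad(h⁻¹) ∘ ω` for the principal right action `r^h(u) = u h` -/
  form_equivariant : ∀ (h : P) (u : T) (ξ : TangentSpace (𝓡 dT) u),
    form (u <• h) (mfderiv (𝓡 dT) (𝓡 dT) (fun v : T => v <• h) u ξ) = Ad dG G (h : G)⁻¹ (form u ξ)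
  /-- `ω` reproduces the generators of the fundamental vector fields `u ↦ d/dt|₀ u exp(t a)` -/
  form_fundamental : ∀ (u : T) (a : LieAlg dP P),
    form (u <• (1 : P)) (mfderiv (𝓡 dP) (𝓡 dT) (fun h : P => u <• h) 1 a) = lieIncl dG dP P a

namespace CartanGeometry

variable (Γ : CartanGeometry dG dP dT dM P T M)

/-- The inverse `𝔤 → T_u T` of the value `ω_u` of the Cartan connection. -/
def formInv (u : T) : LieAlg dG G →L[ℝ] TangentSpace (𝓡 dT) u :=
  LinearMap.toContinuousLinearMap
    (LinearEquiv.ofBijective (Γ.form u).toLinearMap (Γ.bijective_form u)).symm.toLinearMap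

/-- Smooth sections over `U ⊆ M` of the natural bundle `T ×_P V` induced by a representation `ρ` of
`P` on `V`, as `P`-equivariant smooth functions `proj⁻¹(U) → V`; the section attached to `s` maps
`proj u` to the class of `(u, s u)`. (Values outside `proj⁻¹(U)` are irrelevant.) -/
structure Section {V : Type*} [NormedAddCommGroup V] [NormedSpace ℝ V]
    (ρ : Representation ℝ P V) (U : Set M) where
  /-- the equivariant function -/
  toFun : T → V
  contMDiffOn : ContMDiffOn (𝓡 dT) 𝓘(ℝ, V) ∞ toFun (Γ.proj ⁻¹' U)
  equivariant : ∀ u ∈ Γ.proj ⁻¹' U, ∀ h : P, toFun (u <• h) = ρ h⁻¹ (toFun u)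

instance {V : Type*} [NormedAddCommGroup V] [NormedSpace ℝ V] (ρ : Representation ℝ P V)
    (U : Set M) : CoeFun (Γ.Section ρ U) fun _ => T → V := ⟨Section.toFun⟩

/-- Sections over `U` of the adjoint tractor bundle `𝒜M = T ×_P 𝔤`. -/
abbrev AdjointSection (U : Set M) := Γ.Section ((Ad dG G).comp P.subtype) U

/-- The fundamental derivative, as the operator `D : Γ(VM) → Γ(𝒜*M ⊗ VM)` on equivariant functions:
`(D f)(u)(X)` is the derivative of `f` at `u` in the direction `ω_u⁻¹(X)`. For a section `s` of `𝒜M`,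
corresponding to the vector field `u ↦ ω_u⁻¹(s u)`, one has `D_s f = (D f)(s)`. -/
def D {V : Type*} [NormedAddCommGroup V] [NormedSpace ℝ V] (f : T → V) (u : T) :
    LieAlg dG G →L[ℝ] V :=
  (mvfderiv (𝓡 dT) f u).comp (Γ.formInv u)

/-- The curved Casimir operator `(B ⊗ id) ∘ D²`, where `D² f = D (D f)` is a section of
`𝒜*M ⊗ 𝒜*M ⊗ WM`. -/
def curvedCasimir [LieAlgebra.IsKilling ℝ (LieAlg dG G)] {W : Type*} [NormedAddCommGroup W]
    [NormedSpace ℝ W] (f : T → W) (u : T) : W :=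
  killingContraction ((ContinuousLinearMap.coeLM ℝ).comp (Γ.D (Γ.D f) u).toLinearMap)

/-- `{X_i, A_r, Z^i}` is an adapted frame of `𝒜M` over `U`, where `𝒜⁰M` and `𝒜¹M` are the subbundles
of `𝒜M` induced by `𝔭` and `𝔭₊`. -/
structure IsAdaptedFrame (gr : ℤ → Submodule ℝ (LieAlg dG G)) (U : Set M) {ι κ : Type*}
    [DecidableEq ι] (X : ι → Γ.AdjointSection U) (A : κ → Γ.AdjointSection U)
    (Z : ι → Γ.AdjointSection U) : Prop where
  linearIndependent : ∀ u ∈ Γ.proj ⁻¹' U, LinearIndependent ℝ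
    (Sum.elim (fun i => X i u) (Sum.elim (fun r => A r u) (fun i => Z i u)))
  span_eq_top : ∀ u ∈ Γ.proj ⁻¹' U, Submodule.span ℝ
    (Set.range (Sum.elim (fun i => X i u) (Sum.elim (fun r => A r u) (fun i => Z i u)))) = ⊤
  Z_mem : ∀ i, ∀ u ∈ Γ.proj ⁻¹' U, Z i u ∈ filt gr 1
  A_mem : ∀ r, ∀ u ∈ Γ.proj ⁻¹' U, A r u ∈ lieSub dG dP P
  killing_X_X : ∀ i j, ∀ u ∈ Γ.proj ⁻¹' U, killingForm ℝ (LieAlg dG G) (X i u) (X j u) = 0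
  killing_X_A : ∀ i r, ∀ u ∈ Γ.proj ⁻¹' U, killingForm ℝ (LieAlg dG G) (X i u) (A r u) = 0
  killing_X_Z : ∀ i j, ∀ u ∈ Γ.proj ⁻¹' U,
    killingForm ℝ (LieAlg dG G) (X i u) (Z j u) = if i = j then 1 else 0

end CartanGeometry

end Geometry

end ParabolicGeometry

end

/-! The contraction with `B` may be computed in any basis of 𝔤, so at a point u the operator is the
sum of D²σ(e_j, e'_j) over the values of the adapted frame and its dual. Every pair has an entry in
𝔭, and in such a direction equivariance turns derivatives into algebra: (a) D_zσ = -z•σ for z in 𝔭,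
at every point, hence D²σ(x, z) = -z•D_xσ for every x (`D_of_mem_lieSub`, `D_D_apply_mem_lieSub`).
(b) Dσ is itself equivariant, with values in Hom(𝔤, W), hence D²σ(z, y) = -z•D_yσ + D_{[z,y]}σ for z
in 𝔭 (`D_D_mem_lieSub_apply`). The pairs (X_i, Z^i) and (Z^i, X_i) each contribute -Z^i•D_{X_i}σ,
whence the factor 2. The pairs (A_r, A^r) give A^r•A_r•σ. What remains is the derivative along
∑[Z^i, X_i], which is algebraic by (a) once this sum lies in 𝔭.

The memberships in 𝔭 rest on 𝔭 being the Killing complement of 𝔭₊. The A^r are orthogonal to the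
Z^i, which span 𝔭₊ by a dimension count. For w in 𝔭₊, B(∑[Z^i, X_i], w) is the trace of ad w
followed by the projection to 𝔭₊, and it vanishes because ad w raises degrees.

The analytic input is that Ad has derivative ad for the bracket of left invariant fields
(`mvfderiv_Ad`), a Leibniz rule for smooth representations, and differentiability of Dσ. -/

namespace ParabolicGeometry

/-! ### Killing form and traces on a graded Lie algebra -/

section Graded

variable {L : Type*} [LieRing L] [LieAlgebra ℝ L]

theorem mem_filt {L : Type*} [AddCommGroup L] [Module ℝ L] (gr : ℤ → Submodule ℝ L) {i j : ℤ}
    (h : i ≤ j) {x : L} (hx : x ∈ gr j) : x ∈ filt gr i :=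
  (le_iSup₂_of_le (f := fun j (_ : i ≤ j) => gr j) j h le_rfl) hx

theorem filt_le {L : Type*} [AddCommGroup L] [Module ℝ L] {gr : ℤ → Submodule ℝ L} {i : ℤ}
    {S : Submodule ℝ L} (h : ∀ j, i ≤ j → gr j ≤ S) : filt gr i ≤ S :=
  iSup₂_le h

variable (gr : ℤ → Submodule ℝ L) [GradedLieAlgebra gr]

theorem trace_eq_zero_of_shift [FiniteDimensional ℝ L] {k : ℤ} (hk : k ≠ 0) {f : Module.End ℝ L}
    (hf : ∀ i, ∀ x ∈ gr i, f x ∈ gr (k + i)) : LinearMap.trace ℝ L f = 0 :=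
  LinearMap.trace_eq_zero_of_mapsTo_ne (DirectSum.Decomposition.isInternal gr) (fun i => k + i)
    (fun i h => hk (by linarith)) (fun i _ hx => hf i _ hx)

/-- The composite ad x ∘ ad y shifts degrees by i + j ≠ 0, so it has no diagonal blocks and its
trace vanishes. -/
theorem killingForm_eq_zero_of_mem [FiniteDimensional ℝ L] {i j : ℤ} (h : i + j ≠ 0) {x y : L}
    (hx : x ∈ gr i) (hy : y ∈ gr j) : killingForm ℝ L x y = 0 := by
  rw [LieModule.traceForm_apply_apply]
  refine trace_eq_zero_of_shift gr h fun l z hz => ?_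
  rw [add_assoc]
  exact SetLike.GradedBracket.bracket_mem hx (SetLike.GradedBracket.bracket_mem hy hz)

theorem killingForm_eq_zero_of_mem_filt [FiniteDimensional ℝ L] {i j : ℤ} (h : 0 < i + j) {x y : L}
    (hx : x ∈ filt gr i) (hy : y ∈ filt gr j) : killingForm ℝ L x y = 0 := by
  have h1 : filt gr i ≤ LinearMap.ker ((killingForm ℝ L).flip y) := filt_le fun a ha x hx => by
    have h2 : filt gr j ≤ LinearMap.ker (killingForm ℝ L x) := filt_le fun b hb y hy =>
      killingForm_eq_zero_of_mem gr (by omega) hx hy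
    exact h2 hy
  exact h1 hx

/-- `𝔭` contains the orthogonal complement of `𝔭₊`. -/
theorem mem_filt_zero_of_orthogonal [FiniteDimensional ℝ L] [LieAlgebra.IsKilling ℝ L] {x : L}
    (h : ∀ y ∈ filt gr 1, killingForm ℝ L x y = 0) : x ∈ filt gr 0 := by
  classical
  rw [← DirectSum.sum_support_decompose gr x]
  refine Submodule.sum_mem _ fun j _ => ?_
  rcases le_or_gt 0 j with hj | hj
  · exact mem_filt gr hj (SetLike.coe_mem _)
  suffices h0 : ((DirectSum.decompose gr x j : gr j) : L) = 0 by
    rw [h0]; exact zero_mem _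
  -- A component x_j with j < 0 is tested against homogeneous y. Only degree -j ≥ 1 can pair with
  -- it; there y is in 𝔭₊ and the pairing equals B(x, y) = 0.
  refine (LieAlgebra.IsKilling.killingForm_nondegenerate ℝ L).1 _ fun y => ?_
  induction y using DirectSum.Decomposition.inductionOn gr with
  | zero => simp
  | add a b ha hb => simp [ha, hb]
  | @homogeneous i y =>
    rcases eq_or_ne (j + i) 0 with hij | hij
    · have hx : killingForm ℝ L x y = 0 := h _ (mem_filt gr (by omega) y.2)
      rw [← DirectSum.sum_support_decompose gr x, map_sum, LinearMap.sum_apply] at hx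
      by_cases hjs : j ∈ DFinsupp.support (DirectSum.decompose gr x)
      · rwa [Finset.sum_eq_single_of_mem j hjs fun l _ hl =>
          killingForm_eq_zero_of_mem gr (by omega) (SetLike.coe_mem _) y.2] at hx
      · rw [DFinsupp.notMem_support_iff.1 hjs]; simp
    · exact killingForm_eq_zero_of_mem gr hij (SetLike.coe_mem _) y.2

theorem orthogonal_filt_one [FiniteDimensional ℝ L] [LieAlgebra.IsKilling ℝ L] :
    (killingForm ℝ L).orthogonal (filt gr 1) = filt gr 0 := by
  ext x
  refine ⟨fun h => mem_filt_zero_of_orthogonal gr fun y hy => ?_, fun h y hy => ?_⟩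
  · rw [LieModule.traceForm_comm]; exact h y hy
  · exact killingForm_eq_zero_of_mem_filt gr (by norm_num) hy h

theorem finrank_filt [FiniteDimensional ℝ L] [LieAlgebra.IsKilling ℝ L] :
    Module.finrank ℝ (filt gr 0) + Module.finrank ℝ (filt gr 1) = Module.finrank ℝ L := by
  have h := LinearMap.BilinForm.finrank_orthogonal
    (LieAlgebra.IsKilling.killingForm_nondegenerate ℝ L) (filt gr 1)
  rw [orthogonal_filt_one] at h
  have := Submodule.finrank_le (filt gr 1)
  omega

/-- Truncation to the components of degree at least i. Being degree preserving, it can be inserted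
in a trace without spoiling a degree shift. -/
theorem exists_proj_filt (i : ℤ) : ∃ f : Module.End ℝ L, (∀ x, f x ∈ filt gr i) ∧
    (∀ x ∈ filt gr i, f x = x) ∧ ∀ j, ∀ x ∈ gr j, f x ∈ gr j := by
  classical
  set f : Module.End ℝ L := (DirectSum.decomposeLinearEquiv gr).symm.toLinearMap ∘ₗ
    DFinsupp.filterLinearMap ℝ (fun j => gr j) (fun j => i ≤ j) ∘ₗ
      (DirectSum.decomposeLinearEquiv gr).toLinearMap
  have hf : ∀ j, ∀ x ∈ gr j, f x = if i ≤ j then x else 0 := fun j x hx => by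
    change (DirectSum.decompose gr).symm (DFinsupp.filter (fun j => i ≤ j)
      (DirectSum.decompose gr x)) = _
    lift x to gr j using hx
    rw [DirectSum.decompose_coe]
    erw [DFinsupp.filter_single]
    split_ifs
    · exact DirectSum.decompose_symm_of gr x
    · exact DirectSum.decompose_symm_zero gr
  refine ⟨f, fun x => ?_, fun x hx => ?_, fun j x hx => ?_⟩
  · induction x using DirectSum.Decomposition.inductionOn gr with
    | zero => simp
    | add a b ha hb => rw [map_add]; exact add_mem ha hb
    | @homogeneous j x =>
      rw [hf j x x.2]
      split_ifs with h
      · exact mem_filt gr h x.2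
      · exact zero_mem _
  · have : filt gr i ≤ LinearMap.eqLocus f LinearMap.id := filt_le fun j hj x hx => by
      change f x = x
      rw [hf j x hx, if_pos hj]
    exact this hx
  · rw [hf j x hx]
    split_ifs
    · exact hx
    · exact zero_mem _

theorem lie_mem_filt {i j : ℤ} {x y : L} (hx : x ∈ filt gr i) (hy : y ∈ filt gr j) :
    ⁅x, y⁆ ∈ filt gr (i + j) := by
  have h1 : filt gr i ≤ (filt gr (i + j)).comap (LinearMap.flip (LieModule.toEnd ℝ L L : L →ₗ[ℝ] Module.End ℝ L) y) :=
    filt_le fun a ha x hx => by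
      have h2 : filt gr j ≤ (filt gr (i + j)).comap (LieModule.toEnd ℝ L L x) :=
        filt_le fun b hb y hy =>
          mem_filt gr (add_le_add ha hb) (SetLike.GradedBracket.bracket_mem hx hy)
      exact h2 hy
  exact h1 hx

theorem trace_proj_comp_ad [FiniteDimensional ℝ L] {f : Module.End ℝ L}
    (hf : ∀ j, ∀ x ∈ gr j, f x ∈ gr j) {w : L} (hw : w ∈ filt gr 1) :
    LinearMap.trace ℝ L (f ∘ₗ LieModule.toEnd ℝ L L w) = 0 := by
  have h : filt gr 1 ≤ LinearMap.ker
      (LinearMap.trace ℝ L ∘ₗ LinearMap.llcomp ℝ L L L f ∘ₗ (LieModule.toEnd ℝ L L : L →ₗ[ℝ] Module.End ℝ L)) :=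
    filt_le fun j hj x hx => trace_eq_zero_of_shift gr (k := j) (by omega) fun i y hy =>
      hf _ _ (SetLike.GradedBracket.bracket_mem hx hy)
  exact h hw

end Graded

/-! ### Linear algebra of adapted bases -/

section Frame

variable {L : Type*} [LieRing L] [LieAlgebra ℝ L]

theorem IsKillingDual.trace_eq {J : Type*} [Fintype J] [DecidableEq J] (e : Module.Basis J ℝ L)
    {e' : J → L} (h : IsKillingDual e e') (f : Module.End ℝ L) :
    LinearMap.trace ℝ L f = ∑ j, killingForm ℝ L (f (e j)) (e' j) := by
  rw [LinearMap.trace_eq_matrix_trace ℝ e, Matrix.trace]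
  refine Finset.sum_congr rfl fun j _ => ?_
  rw [Matrix.diag_apply, LinearMap.toMatrix_apply]
  conv_rhs => rw [← e.sum_repr (f (e j)), map_sum, LinearMap.sum_apply]
  simp [h _ _]

variable [FiniteDimensional ℝ L] [LieAlgebra.IsKilling ℝ L] (gr : ℤ → Submodule ℝ L) [GradedLieAlgebra gr]
  {ι κ : Type*} [Fintype ι] [Fintype κ]
  {X Z : ι → L} {A A' : κ → L}

/-- For an adapted basis of `𝔤`, the elements `Zⁱ` span `𝔭₊`. -/
theorem filt_one_le_span
    (hli : LinearIndependent ℝ (Sum.elim X (Sum.elim A Z)))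
    (hsp : Submodule.span ℝ (Set.range (Sum.elim X (Sum.elim A Z))) = ⊤)
    (hZ : ∀ i, Z i ∈ filt gr 1) (hA : ∀ r, A r ∈ filt gr 0) :
    filt gr 1 ≤ Submodule.span ℝ (Set.range Z) := by
  have hAZ : LinearIndependent ℝ (Sum.elim A Z) := hli.comp Sum.inr Sum.inr_injective
  have hZli : LinearIndependent ℝ Z := hAZ.comp Sum.inr Sum.inr_injective
  have hcard : Module.finrank ℝ L = Fintype.card ι + (Fintype.card κ + Fintype.card ι) := by
    rw [Module.finrank_eq_card_basis (Module.Basis.mk hli hsp.ge), Fintype.card_sum,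
      Fintype.card_sum]
  have h1 : Submodule.span ℝ (Set.range (Sum.elim A Z)) ≤ filt gr 0 := by
    rw [Submodule.span_le]
    rintro _ ⟨j | j, rfl⟩
    · exact hA j
    · exact filt_anti gr zero_le_one (hZ j)
  have h2 := Submodule.finrank_mono h1
  rw [finrank_span_eq_card hAZ, Fintype.card_sum] at h2
  have h3 : Submodule.span ℝ (Set.range Z) ≤ filt gr 1 := by
    rw [Submodule.span_le]
    rintro _ ⟨j, rfl⟩
    exact hZ j
  have h4 := Submodule.finrank_mono h3
  rw [finrank_span_eq_card hZli] at h4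
  have h5 := finrank_filt gr
  -- Since dim 𝔤 = 2|ι| + |κ| and dim 𝔭 ≥ |ι| + |κ|, complementarity of dimensions forces dim 𝔭₊ ≤
  -- |ι|.
  refine (Submodule.eq_of_le_of_finrank_le h3 ?_).ge
  rw [finrank_span_eq_card hZli]
  omega

variable [DecidableEq ι] [DecidableEq κ]

theorem dual_mem_filt_zero
    (hli : LinearIndependent ℝ (Sum.elim X (Sum.elim A Z)))
    (hsp : Submodule.span ℝ (Set.range (Sum.elim X (Sum.elim A Z))) = ⊤)
    (hZ : ∀ i, Z i ∈ filt gr 1) (hA : ∀ r, A r ∈ filt gr 0)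
    (hd : IsKillingDual (Sum.elim X (Sum.elim A Z)) (Sum.elim Z (Sum.elim A' X))) (r : κ) :
    A' r ∈ filt gr 0 := by
  refine mem_filt_zero_of_orthogonal gr fun y hy => ?_
  rw [LieModule.traceForm_comm]
  have h : Submodule.span ℝ (Set.range Z) ≤ LinearMap.ker ((killingForm ℝ L).flip (A' r)) := by
    rw [Submodule.span_le]
    rintro _ ⟨i, rfl⟩
    simpa using! hd (Sum.inr (Sum.inr i)) (Sum.inr (Sum.inl r))
  exact h (filt_one_le_span gr hli hsp hZ hA hy)

/-- With f the projection to 𝔭₊ and w in 𝔭₊, the trace of f ∘ ad w is zero. Expanded in the adapted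
basis, its Z-part is B(w, ∑[Z^i, X_i]) and the other parts vanish, so the sum is orthogonal to 𝔭₊.
-/
theorem sum_lie_mem_filt_zero
    (hli : LinearIndependent ℝ (Sum.elim X (Sum.elim A Z)))
    (hsp : Submodule.span ℝ (Set.range (Sum.elim X (Sum.elim A Z))) = ⊤)
    (hZ : ∀ i, Z i ∈ filt gr 1) (hA : ∀ r, A r ∈ filt gr 0)
    (hd : IsKillingDual (Sum.elim X (Sum.elim A Z)) (Sum.elim Z (Sum.elim A' X))) :
    ∑ i, ⁅Z i, X i⁆ ∈ filt gr 0 := by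
  refine mem_filt_zero_of_orthogonal gr fun w hw => ?_
  obtain ⟨f, hf, hf', hf''⟩ := exists_proj_filt gr 1
  have ht := trace_proj_comp_ad gr hf'' hw
  have hd' : IsKillingDual (Module.Basis.mk hli hsp.ge) (Sum.elim Z (Sum.elim A' X)) := by
    rw [Module.Basis.coe_mk]; exact hd
  rw [hd'.trace_eq, Module.Basis.coe_mk, Fintype.sum_sum_type, Fintype.sum_sum_type] at ht
  simp only [Sum.elim_inl, Sum.elim_inr, LinearMap.comp_apply, LieModule.toEnd_apply_apply] at ht
  -- The X- and A-terms pair f(…) in 𝔭₊ with Z^i in 𝔭₊ or A^r in 𝔭, and 𝔭₊ is orthogonal to 𝔭.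
  rw [Finset.sum_eq_zero fun i _ =>
      killingForm_eq_zero_of_mem_filt gr (by norm_num) (hf _) (hZ i),
    Finset.sum_eq_zero fun r _ => killingForm_eq_zero_of_mem_filt gr (by norm_num) (hf _)
      (dual_mem_filt_zero gr hli hsp hZ hA hd r), zero_add, zero_add] at ht
  rw [map_sum, LinearMap.sum_apply, ← ht]
  refine Finset.sum_congr rfl fun i _ => ?_
  -- Here [w, Z^i] has degree at least 2, so f fixes it; invariance of B then moves the bracket.
  rw [hf' _ (filt_anti gr (by norm_num) (lie_mem_filt gr hw (hZ i))),
    LieModule.traceForm_comm ℝ L L ⁅Z i, X i⁆, LieModule.traceForm_apply_lie_apply]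

end Frame

/-! ### The derivative of conjugation for a local multiplication -/

section LocalGroup

open Filter Topology VectorField

variable {E : Type*} [NormedAddCommGroup E] [NormedSpace ℝ E] [CompleteSpace E]

/-- For a local multiplication `m` with unit `e`, let `C h` be the derivative at `e` of the
conjugation with `h`. Its derivative at `h = e` is the bracket of left invariant vector fields. -/
theorem hasFDerivAt_conj_of_localMul {m : E × E → E} {e : E} (hm : ContDiffAt ℝ 2 m (e, e))
    (hr : ∀ᶠ x in 𝓝 e, m (x, e) = x) (hl : ∀ᶠ x in 𝓝 e, m (e, x) = x) {C : E → E →L[ℝ] E}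
    (hC : ∀ᶠ h in 𝓝 e,
      (fderiv ℝ (fun x => m (x, h)) e).comp (C h) = fderiv ℝ (fun x => m (h, x)) e)
    {V : E → E → E} (hV : ∀ b, ∀ᶠ y in 𝓝 e, V b y = fderiv ℝ (fun x => m (y, x)) e b) :
    ∃ C' : E →L[ℝ] E →L[ℝ] E, HasFDerivAt C C' e ∧ ∀ a b, C' a b = lieBracket ℝ (V a) (V b) e := by
  set D := fderiv ℝ m
  set D' := fderiv ℝ D (e, e)
  have hD : HasFDerivAt D D' (e, e) :=
    ((hm.fderiv_right (m := 1) (by norm_num)).differentiableAt (by norm_num)).hasFDerivAt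
  have hsymm : IsSymmSndFDerivAt ℝ m (e, e) := hm.isSymmSndFDerivAt (by simp)
  have hdm : ∀ᶠ p in 𝓝 (e, e), DifferentiableAt ℝ m p :=
    (hm.eventually (by simp)).mono fun p hp => hp.differentiableAt (by norm_num)
  have tl : Tendsto (fun h : E => (h, e)) (𝓝 e) (𝓝 (e, e)) :=
    (Continuous.prodMk continuous_id continuous_const).tendsto e
  have tr : Tendsto (fun h : E => (e, h)) (𝓝 e) (𝓝 (e, e)) :=
    (Continuous.prodMk continuous_const continuous_id).tendsto e
  have dR : ∀ h, DifferentiableAt ℝ m (e, h) →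
      fderiv ℝ (fun x => m (x, h)) e = (D (e, h)).comp (.inl ℝ E E) := fun h hh =>
    (HasFDerivAt.comp e (f := fun x => (x, h)) hh.hasFDerivAt (hasFDerivAt_prodMk_left e h)).fderiv
  have dL : ∀ h, DifferentiableAt ℝ m (h, e) →
      fderiv ℝ (fun x => m (h, x)) e = (D (h, e)).comp (.inr ℝ E E) := fun h hh =>
    (HasFDerivAt.comp e (f := fun x => (h, x)) hh.hasFDerivAt (hasFDerivAt_prodMk_right h e)).fderiv
  set R : E → E →L[ℝ] E := fun h => (D (e, h)).comp (.inl ℝ E E)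
  set S : E → E →L[ℝ] E := fun h => (D (h, e)).comp (.inr ℝ E E)
  have eR : ∀ᶠ h in 𝓝 e, fderiv ℝ (fun x => m (x, h)) e = R h := tr.eventually hdm |>.mono dR
  have eL : ∀ᶠ h in 𝓝 e, fderiv ℝ (fun x => m (h, x)) e = S h := tl.eventually hdm |>.mono dL
  have hR1 : R e = .id ℝ E := by
    rw [← eR.self_of_nhds]
    exact (EventuallyEq.fderiv_eq hr).trans fderiv_id
  have hS1 : S e = .id ℝ E := by
    rw [← eL.self_of_nhds]
    exact (EventuallyEq.fderiv_eq hl).trans fderiv_id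
  have hR : HasFDerivAt R (((ContinuousLinearMap.compL ℝ E (E × E) E).flip (.inl ℝ E E)).comp
      (D'.comp (.inr ℝ E E))) e :=
    ((ContinuousLinearMap.compL ℝ E (E × E) E).flip (.inl ℝ E E)).hasFDerivAt.comp e
      (HasFDerivAt.comp e (f := fun x => (e, x)) hD (hasFDerivAt_prodMk_right e e))
  have hS : HasFDerivAt S (((ContinuousLinearMap.compL ℝ E (E × E) E).flip (.inr ℝ E E)).comp
      (D'.comp (.inl ℝ E E))) e :=
    ((ContinuousLinearMap.compL ℝ E (E × E) E).flip (.inr ℝ E E)).hasFDerivAt.comp e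
      (HasFDerivAt.comp e (f := fun x => (x, e)) hD (hasFDerivAt_prodMk_left e e))
  -- Infinitesimal form of (h x h⁻¹) h = h x. It avoids inversion in the chart, and C = R⁻¹ S near e
  -- makes C differentiable.
  have hRC : ∀ᶠ h in 𝓝 e, R h * C h = S h := by
    filter_upwards [hC, eR, eL] with h h1 h2 h3
    rw [← h3, ← h1, h2]; rfl
  have hunit : IsUnit (R e) := by rw [hR1]; exact isUnit_one
  have hCR : C =ᶠ[𝓝 e] fun h => Ring.inverse (R h) * S h := by
    have : ∀ᶠ h in 𝓝 e, IsUnit (R h) :=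
      hR.continuousAt.eventually (Units.isOpen.mem_nhds hunit)
    filter_upwards [hRC, this] with h h1 h2
    rw [← h1, ← mul_assoc, Ring.inverse_mul_cancel _ h2, one_mul]
  have hdC : DifferentiableAt ℝ C e := by
    have hi : DifferentiableAt ℝ Ring.inverse (R e) := differentiableAt_inverse hunit
    exact ((hi.comp e hR.differentiableAt).mul hS.differentiableAt).congr_of_eventuallyEq hCR
  have hC1 : C e = .id ℝ E := by
    have := hRC.self_of_nhds
    rw [hR1, hS1] at this
    exact (one_mul (C e)).symm.trans this
  refine ⟨_, hdC.hasFDerivAt, fun a b => ?_⟩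
  -- Differentiating R C = S at e, where all three are the identity, gives C'(a)b = m''((a,0),(0,b))
  -- - m''((0,a),(b,0)). Symmetry of m'' identifies this with the bracket of the fields y ↦ S y a
  -- and y ↦ S y b.
  have key := DFunLike.congr_fun (DFunLike.congr_fun
    (((hR.mul' hdC.hasFDerivAt).congr_of_eventuallyEq
      (hRC.mono fun _ h => h.symm)).unique hS) a) b
  have hVd : ∀ c, HasFDerivAt (V c) ((ContinuousLinearMap.apply ℝ E c).comp
      (((ContinuousLinearMap.compL ℝ E (E × E) E).flip (.inr ℝ E E)).comp
      (D'.comp (.inl ℝ E E)))) e := fun c => by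
    refine ((ContinuousLinearMap.apply ℝ E c).hasFDerivAt.comp e hS).congr_of_eventuallyEq ?_
    filter_upwards [hV c, eL] with y h1 h2
    rw [h1, h2]; rfl
  have hVe : ∀ c, V c e = c := fun c => by
    rw [(hV c).self_of_nhds, eL.self_of_nhds, hS1]; rfl
  rw [lieBracket, (hVd a).fderiv, (hVd b).fderiv]
  have hs : D' (b, 0) (0, a) = D' (0, a) (b, 0) := hsymm.eq _ _
  simp [hR1, hC1, hVe, hs] at key ⊢
  exact eq_sub_of_add_eq key

end LocalGroup

/-! ### Derivatives in the preferred chart -/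

section ChartDerivative

variable {n n' : ℕ} {M : Type*} [TopologicalSpace M] [ChartedSpace (EuclideanSpace ℝ (Fin n)) M]
  {N : Type*} [TopologicalSpace N] [ChartedSpace (EuclideanSpace ℝ (Fin n')) N]
  {F : Type*} [NormedAddCommGroup F] [NormedSpace ℝ F]

/-- The base point y is kept separate from f x so that the chain rule applies where the two agree
only propositionally, such as g 1 g⁻¹ and 1. -/
theorem mvfderiv_comp_apply_of_eq {g : M → F} {f : N → M} {x : N} {y : M}
    (hg : MDifferentiableAt (𝓡 n) 𝓘(ℝ, F) g y) (hf : MDifferentiableAt (𝓡 n') (𝓡 n) f x)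
    (hy : f x = y) (v : TangentSpace (𝓡 n') x) :
    mvfderiv (𝓡 n') (fun z => g (f z)) x v = mvfderiv (𝓡 n) g y (mfderiv (𝓡 n') (𝓡 n) f x v) := by
  subst hy
  exact mfderiv_comp_apply x hg hf v

theorem mvfderiv_comp_hasFDerivAt {F' : Type*} [NormedAddCommGroup F'] [NormedSpace ℝ F']
    {f : M → F} {g : F → F'} {x : M} {g' : F →L[ℝ] F'} (hg : HasFDerivAt g g' (f x))
    (hf : MDifferentiableAt (𝓡 n) 𝓘(ℝ, F) f x) :
    MDifferentiableAt (𝓡 n) 𝓘(ℝ, F') (fun z => g (f z)) x ∧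
      ∀ v, mvfderiv (𝓡 n) (fun z => g (f z)) x v = g' (mvfderiv (𝓡 n) f x v) := by
  refine ⟨hg.differentiableAt.mdifferentiableAt.comp x hf, fun v => ?_⟩
  have h := HasMFDerivAt.comp x hg.hasMFDerivAt hf.hasMFDerivAt
  exact DFunLike.congr_fun h.mfderiv v

theorem mvfderiv_eq_fderiv {f : M → F} {x : M} (hf : MDifferentiableAt (𝓡 n) 𝓘(ℝ, F) f x) :
    mvfderiv (𝓡 n) f x =
      fderiv ℝ (f ∘ (extChartAt (𝓡 n) x).symm) (extChartAt (𝓡 n) x x) := by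
  rw [hf.mvfderiv, writtenInExtChartAt, ModelWithCorners.range_eq_univ, fderivWithin_univ]
  rfl

theorem mvfderiv_of_hasFDerivAt [IsManifold (𝓡 n) 1 M] {f : M → F} {x : M}
    {f' : EuclideanSpace ℝ (Fin n) →L[ℝ] F}
    (h : HasFDerivAt (f ∘ (extChartAt (𝓡 n) x).symm) f' (extChartAt (𝓡 n) x x)) :
    MDifferentiableAt (𝓡 n) 𝓘(ℝ, F) f x ∧ mvfderiv (𝓡 n) f x = f' := by
  have h1 : MDifferentiableAt (𝓡 n) 𝓘(ℝ, F) f x := by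
    refine (h.differentiableAt.mdifferentiableAt.comp x
      (mdifferentiableAt_extChartAt (mem_chart_source _ x))).congr_of_eventuallyEq ?_
    filter_upwards [extChartAt_source_mem_nhds (I := 𝓡 n) x] with y hy
    rw [Function.comp_apply, Function.comp_apply, (extChartAt (𝓡 n) x).left_inv hy]
  exact ⟨h1, (mvfderiv_eq_fderiv h1).trans h.fderiv⟩

end ChartDerivative

/-! ### The derivative of Ad is ad -/

section Adjoint

open Filter Topology VectorField

variable {dG : ℕ} {G : Type*} [TopologicalSpace G]
  [ChartedSpace (EuclideanSpace ℝ (Fin dG)) G] [Group G] [LieGroup (𝓡 dG) ∞ G]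

variable (dG G) in
/-- The multiplication of a Lie group in the preferred chart at the identity. -/
noncomputable def chartMul (p : EuclideanSpace ℝ (Fin dG) × EuclideanSpace ℝ (Fin dG)) :
    EuclideanSpace ℝ (Fin dG) :=
  extChartAt (𝓡 dG) (1 : G)
    ((extChartAt (𝓡 dG) (1 : G)).symm p.1 * (extChartAt (𝓡 dG) (1 : G)).symm p.2)

variable (dG G) in
theorem contDiffAt_chartMul : ContDiffAt ℝ 2 (chartMul dG G)
    (extChartAt (𝓡 dG) (1 : G) 1, extChartAt (𝓡 dG) (1 : G) 1) := by
  have : IsManifold (𝓡 dG) ∞ G := ContMDiffMul.toIsManifold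
  set φ := extChartAt (𝓡 dG) (1 : G)
  have hs : ContMDiffAt 𝓘(ℝ, EuclideanSpace ℝ (Fin dG)) (𝓡 dG) ∞ φ.symm (φ 1) :=
    (contMDiffOn_extChartAt_symm (1 : G)).contMDiffAt (extChartAt_target_mem_nhds _)
  have h1 : φ.symm (φ 1) = 1 := extChartAt_to_inv (I := 𝓡 dG) (1 : G)
  refine ContDiffAt.of_le (n := ∞) ?_ ENat.LEInfty.out
  rw [← contMDiffAt_iff_contDiffAt]
  refine ContMDiffAt.comp_of_eq (I' := 𝓡 dG) (contMDiffAt_extChartAt (I := 𝓡 dG) (x := (1 : G)))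
    (ContMDiffAt.mul (ContMDiffAt.comp_of_eq hs contDiffAt_fst.contMDiffAt rfl)
      (ContMDiffAt.comp_of_eq hs contDiffAt_snd.contMDiffAt rfl)) ?_
  change φ.symm (φ 1) * φ.symm (φ 1) = 1
  rw [h1, one_mul]

variable (dG G) in
/-- The derivative of the adjoint representation is the adjoint representation of `𝔤`. -/
theorem hasFDerivAt_conjDeriv_chart :
    ∃ C' : EuclideanSpace ℝ (Fin dG) →L[ℝ] EuclideanSpace ℝ (Fin dG) →L[ℝ]
        EuclideanSpace ℝ (Fin dG),
      HasFDerivAt (fun y => (conjDeriv dG ((extChartAt (𝓡 dG) (1 : G)).symm y) :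
        EuclideanSpace ℝ (Fin dG) →L[ℝ] EuclideanSpace ℝ (Fin dG))) C'
        (extChartAt (𝓡 dG) (1 : G) 1) ∧
      ∀ a b : LieAlg dG G, C' a b = ⁅a, b⁆ := by
  have : IsManifold (𝓡 dG) ∞ G := ContMDiffMul.toIsManifold
  have : IsManifold (𝓡 dG) 1 G := IsManifold.of_le (n := ∞) ENat.LEInfty.out
  set φ := extChartAt (𝓡 dG) (1 : G) with hφ
  set e := φ 1
  have ht : φ.target ∈ 𝓝 e := extChartAt_target_mem_nhds _
  have he : φ.symm e = 1 := extChartAt_to_inv (I := 𝓡 dG) (1 : G)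
  have hd : ∀ y ∈ φ.target, MDifferentiableAt (𝓡 dG) (𝓡 dG) φ (φ.symm y) := fun y hy =>
    mdifferentiableAt_extChartAt (by rw [← extChartAt_source (𝓡 dG)]; exact φ.map_target hy)
  have hml : ∀ g : G, MDifferentiableAt (𝓡 dG) (𝓡 dG) (fun x => g * x) 1 := fun g =>
    (contMDiff_mul_left (I := 𝓡 dG) (n := ∞)).mdifferentiableAt (by simp)
  have hmr : ∀ g : G, MDifferentiableAt (𝓡 dG) (𝓡 dG) (fun x => x * g) 1 := fun g =>
    (contMDiff_mul_right (I := 𝓡 dG) (n := ∞)).mdifferentiableAt (by simp)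
  have hL : ∀ y ∈ φ.target, fderiv ℝ (fun x => chartMul dG G (y, x)) e =
      mvfderiv (𝓡 dG) (fun x => φ (φ.symm y * x)) 1 := fun y hy =>
    (mvfderiv_eq_fderiv (MDifferentiableAt.comp_of_eq _ (hd y hy) (hml _) (mul_one _))).symm
  have hR : ∀ y ∈ φ.target, fderiv ℝ (fun x => chartMul dG G (x, y)) e =
      mvfderiv (𝓡 dG) (fun x => φ (x * φ.symm y)) 1 := fun y hy =>
    (mvfderiv_eq_fderiv (MDifferentiableAt.comp_of_eq _ (hd y hy) (hmr _) (one_mul _))).symm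
  obtain ⟨C', hC', hbr⟩ := hasFDerivAt_conj_of_localMul (contDiffAt_chartMul dG G)
    (C := fun y => conjDeriv dG (φ.symm y))
    (V := fun b => mpullbackWithin 𝓘(ℝ, EuclideanSpace ℝ (Fin dG)) (𝓡 dG) φ.symm
      (mulInvariantVectorField (b : GroupLieAlgebra (𝓡 dG) G)) (Set.range (𝓡 dG)))
    (by
      filter_upwards [ht] with x hx
      change φ (φ.symm x * φ.symm e) = x
      rw [he, mul_one, φ.right_inv hx])
    (by
      filter_upwards [ht] with x hx
      change φ (φ.symm e * φ.symm x) = x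
      rw [he, one_mul, φ.right_inv hx])
    (by
      filter_upwards [ht] with y hy
      rw [hL y hy, hR y hy]
      ext1 v
      have h := mvfderiv_comp_apply_of_eq (x := (1 : G)) (y := (1 : G))
        (f := fun x => φ.symm y * x * (φ.symm y)⁻¹)
        (MDifferentiableAt.comp_of_eq _ (hd y hy) (hmr (φ.symm y)) (one_mul _))
        ((contMDiff_conj (φ.symm y)).mdifferentiableAt (by simp)) (by simp) v
      simp only [Function.comp_def, inv_mul_cancel_right] at h
      exact h.symm)
    (fun b => by
      filter_upwards [ht] with y hy
      rw [hL y hy]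
      refine Eq.trans ?_ (mvfderiv_comp_apply_of_eq (hd y hy) (hml (φ.symm y)) (mul_one _) b).symm
      have hi : (mfderivWithin 𝓘(ℝ, EuclideanSpace ℝ (Fin dG)) (𝓡 dG) φ.symm
          (Set.range (𝓡 dG)) y).inverse = mfderiv (𝓡 dG) (𝓡 dG) φ (φ.symm y) :=
        ContinuousLinearMap.inverse_eq (mfderivWithin_extChartAt_symm_comp_mfderiv_extChartAt hy)
          (mfderiv_extChartAt_comp_mfderivWithin_extChartAt_symm hy)
      exact DFunLike.congr_fun hi _)
  refine ⟨C', hC', fun a b => (hbr a b).trans ?_⟩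
  -- Tangent vectors at 1 are coordinates in the preferred chart at 1, so this chart has identity
  -- derivative there and the bracket of the pulled back fields is the bracket of 𝔤.
  have hid : mvfderiv (𝓡 dG) φ 1 = .id ℝ (EuclideanSpace ℝ (Fin dG)) := by
    refine (mvfderiv_of_hasFDerivAt ((hasFDerivAt_id e).congr_of_eventuallyEq ?_)).2
    filter_upwards [ht] with x hx using φ.right_inv hx
  have hinv : (mfderiv (𝓡 dG) (𝓡 dG) φ 1).inverse = .id ℝ (EuclideanSpace ℝ (Fin dG)) := by
    refine (congrArg ContinuousLinearMap.inverse hid).trans ContinuousLinearMap.inverse_id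
  rw [GroupLieAlgebra.bracket_def, ← mlieBracketWithin_univ, mlieBracketWithin_apply, ← hφ]
  refine Eq.trans ?_ (DFunLike.congr_fun hinv _).symm
  rw [Set.preimage_univ, Set.univ_inter, ModelWithCorners.range_eq_univ]
  exact congrFun lieBracketWithin_univ.symm _

/-- The adjoint representation of `G` on `𝔤` has the adjoint representation of `𝔤` as its
infinitesimal representation. -/
theorem mvfderiv_Ad (b : LieAlg dG G) :
    MDifferentiableAt (𝓡 dG) 𝓘(ℝ, LieAlg dG G) (fun g : G => Ad dG G g b) 1 ∧
      ∀ a : LieAlg dG G, mvfderiv (𝓡 dG) (fun g : G => Ad dG G g b) 1 a = ⁅a, b⁆ := by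
  have : IsManifold (𝓡 dG) ∞ G := ContMDiffMul.toIsManifold
  have : IsManifold (𝓡 dG) 1 G := IsManifold.of_le (n := ∞) ENat.LEInfty.out
  obtain ⟨C', hC', hbr⟩ := hasFDerivAt_conjDeriv_chart dG G
  have hd := (ContinuousLinearMap.apply ℝ (EuclideanSpace ℝ (Fin dG))
    (b : EuclideanSpace ℝ (Fin dG))).hasFDerivAt.comp _ hC'
  have hd' := mvfderiv_of_hasFDerivAt (F := EuclideanSpace ℝ (Fin dG))
    (f := fun g : G => (Ad dG G g b : EuclideanSpace ℝ (Fin dG))) (x := (1 : G)) (f' := _) hd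
  exact ⟨hd'.1, fun a => (DFunLike.congr_fun hd'.2 a).trans (hbr a b)⟩

end Adjoint

/-! ### Smooth representations and their Leibniz rule -/

section SmoothRepresentation

variable {n : ℕ} {M : Type*} [TopologicalSpace M] [ChartedSpace (EuclideanSpace ℝ (Fin n)) M]
  {F : Type*} [NormedAddCommGroup F] [NormedSpace ℝ F]

theorem hasFDerivAt_chart {f : M → F} {x : M} (hf : MDifferentiableAt (𝓡 n) 𝓘(ℝ, F) f x) :
    HasFDerivAt (f ∘ (extChartAt (𝓡 n) x).symm)
      (mvfderiv (𝓡 n) f x : EuclideanSpace ℝ (Fin n) →L[ℝ] F) (extChartAt (𝓡 n) x x) := by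
  have h3 : DifferentiableAt ℝ (f ∘ (extChartAt (𝓡 n) x).symm) (extChartAt (𝓡 n) x x) := by
    have h := hf.2
    rw [DifferentiableWithinAtProp, ModelWithCorners.range_eq_univ, Set.inter_univ] at h
    exact differentiableWithinAt_univ.1 h
  have h4 := h3.hasFDerivAt
  rwa [← mvfderiv_eq_fderiv hf] at h4

theorem mvfderiv_clm_comp {F' : Type*} [NormedAddCommGroup F'] [NormedSpace ℝ F'] (L : F →L[ℝ] F')
    {f : M → F} {x : M} (hf : MDifferentiableAt (𝓡 n) 𝓘(ℝ, F) f x) (v : TangentSpace (𝓡 n) x) :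
    mvfderiv (𝓡 n) (fun y => L (f y)) x v = L (mvfderiv (𝓡 n) f x v) :=
  (mvfderiv_comp_hasFDerivAt L.hasFDerivAt hf).2 v

variable {dG dP : ℕ} {G : Type*} [TopologicalSpace G]
  [ChartedSpace (EuclideanSpace ℝ (Fin dG)) G] [Group G]
  {P : Subgroup G} [ChartedSpace (EuclideanSpace ℝ (Fin dP)) P]
  {W : Type*} [NormedAddCommGroup W] [NormedSpace ℝ W]
  {ρ : Representation ℝ P W}

theorem IsSmoothRep.mdifferentiableAt (hρ : IsSmoothRep (dP := dP) ρ) (w : W) (h : P) :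
    MDifferentiableAt (𝓡 dP) 𝓘(ℝ, W) (fun h : P => ρ h w) h :=
  (hρ w).mdifferentiableAt (by simp)

variable [FiniteDimensional ℝ W]

/-- The infinitesimal representation, as a linear map on `W`. -/
theorem IsSmoothRep.exists_clm (hρ : IsSmoothRep (dP := dP) ρ) (a : LieAlg dP P) :
    ∃ L : W →L[ℝ] W, ∀ w, mvfderiv (𝓡 dP) (fun h : P => ρ h w) 1 a = L w := by
  let L : W →ₗ[ℝ] W :=
    { toFun := fun w => mvfderiv (𝓡 dP) (fun h : P => ρ h w) 1 a
      map_add' := fun w w' => by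
        simp only [map_add]
        rw [mvfderiv_fun_add (hρ.mdifferentiableAt w 1) (hρ.mdifferentiableAt w' 1)]
        rfl
      map_smul' := fun c w => by
        simp only [map_smul]
        exact mvfderiv_clm_comp (c • ContinuousLinearMap.id ℝ W) (hρ.mdifferentiableAt w 1) a }
  exact ⟨L.toContinuousLinearMap, fun w => rfl⟩

/-- The Leibniz rule for the action of a smooth representation. -/
theorem IsSmoothRep.mvfderiv_apply [IsManifold (𝓡 dP) 1 P] (hρ : IsSmoothRep (dP := dP) ρ)
    {w : P → W} (hw : MDifferentiableAt (𝓡 dP) 𝓘(ℝ, W) w 1) (a : LieAlg dP P) :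
    mvfderiv (𝓡 dP) (fun h : P => ρ h (w h)) 1 a =
      mvfderiv (𝓡 dP) (fun h : P => ρ h (w 1)) 1 a + mvfderiv (𝓡 dP) w 1 a := by
  obtain ⟨L, hL⟩ := hρ.exists_clm a
  set b := Module.finBasis ℝ W
  set φ := extChartAt (𝓡 dP) (1 : P)
  let c : ∀ i, W →L[ℝ] ℝ := fun i => (b.coord i).toContinuousLinearMap
  have hc : ∀ v, ∑ i, c i v • b i = v := fun v => b.sum_repr v
  have hφ : φ.symm (φ 1) = 1 := extChartAt_to_inv (I := 𝓡 dP) (1 : P)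
  -- Smoothness is only known for orbit maps of fixed vectors. Expanding w(h) in a basis b of W
  -- reduces to the product rule for ∑ c_i(w(h)) ρ(h) b_i.
  have key := HasFDerivAt.fun_sum (u := Finset.univ) fun i _ =>
    (((c i).hasFDerivAt.comp _ (hasFDerivAt_chart hw)).smul
      (hasFDerivAt_chart (hρ.mdifferentiableAt (b i) 1)))
  have h1 := mvfderiv_of_hasFDerivAt (f := fun h : P => ρ h (w h)) (key.congr_of_eventuallyEq
    (Filter.Eventually.of_forall fun y => by
      change ρ (φ.symm y) (w (φ.symm y)) = ∑ i, c i (w (φ.symm y)) • ρ (φ.symm y) (b i)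
      conv_lhs => rw [← hc (w (φ.symm y)), map_sum]
      simp only [map_smul]))
  refine (DFunLike.congr_fun h1.2 a).trans ?_
  have h2 : ∀ i, mvfderiv (𝓡 dP) (fun h : P => ρ h (b i)) 1 a = L (b i) := fun i => hL _
  have h3 : ∑ i, (c i (w 1) • L (b i) + c i (mvfderiv (𝓡 dP) w 1 a) • b i) =
      L (w 1) + mvfderiv (𝓡 dP) w 1 a := by
    rw [Finset.sum_add_distrib, hc]
    simp only [← map_smul]
    rw [← map_sum, hc]
  rw [hL, ← h3]
  refine (map_sum (ContinuousLinearMap.apply ℝ W (a : EuclideanSpace ℝ (Fin dP))) _ _).trans ?_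
  refine Finset.sum_congr rfl fun i _ => ?_
  rw [← h2]
  change c i (w (φ.symm (φ 1))) • _ + c i (mvfderiv (𝓡 dP) w 1 a) • ρ (φ.symm (φ 1)) (b i) = _
  rw [hφ, map_one]
  rfl

end SmoothRepresentation

/-! ### Coordinate frames on the total space -/

section ChartFrame

variable {dT : ℕ} {T : Type*} [TopologicalSpace T] [ChartedSpace (EuclideanSpace ℝ (Fin dT)) T]

/-- The derivative of the inverse of the preferred chart at `u`. -/
noncomputable def chartFrame (u : T) (y : EuclideanSpace ℝ (Fin dT)) :
    EuclideanSpace ℝ (Fin dT) →L[ℝ] TangentSpace (𝓡 dT) ((extChartAt (𝓡 dT) u).symm y) :=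
  mfderivWithin 𝓘(ℝ, EuclideanSpace ℝ (Fin dT)) (𝓡 dT) (extChartAt (𝓡 dT) u).symm
    (extChartAt (𝓡 dT) u).target y

theorem bijective_chartFrame [IsManifold (𝓡 dT) 1 T] (u : T) {y : EuclideanSpace ℝ (Fin dT)}
    (hy : y ∈ (extChartAt (𝓡 dT) u).target) : Function.Bijective (chartFrame u y) := by
  have h : chartFrame u y = mfderivWithin 𝓘(ℝ, EuclideanSpace ℝ (Fin dT)) (𝓡 dT)
      (extChartAt (𝓡 dT) u).symm (Set.range (𝓡 dT)) y := by
    rw [chartFrame, mfderivWithin_of_isOpen (isOpen_extChartAt_target u) hy,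
      ModelWithCorners.range_eq_univ, mfderivWithin_univ]
  rw [h]
  exact Function.bijective_iff_has_inverse.2 ⟨mfderiv (𝓡 dT) (𝓡 dT) (extChartAt (𝓡 dT) u) _,
    DFunLike.congr_fun (mfderiv_extChartAt_comp_mfderivWithin_extChartAt_symm hy),
    DFunLike.congr_fun (mfderivWithin_extChartAt_symm_comp_mfderiv_extChartAt hy)⟩

end ChartFrame

/-! ### The fundamental derivative and equivariance -/

section Geometry

variable {dG dP dT dM : ℕ} {G : Type*} [TopologicalSpace G]
  [ChartedSpace (EuclideanSpace ℝ (Fin dG)) G] [Group G]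
  {P : Subgroup G} [ChartedSpace (EuclideanSpace ℝ (Fin dP)) P]
  {T : Type*} [TopologicalSpace T] [ChartedSpace (EuclideanSpace ℝ (Fin dT)) T]
  [MulAction Pᵐᵒᵖ T]
  {M : Type*} [TopologicalSpace M] [ChartedSpace (EuclideanSpace ℝ (Fin dM)) M]

/-- An element of `𝔭` is the image of some `a ∈ T₁P` that computes its infinitesimal action. -/
theorem exists_infAct {W : Type*} [NormedAddCommGroup W] [NormedSpace ℝ W]
    (ρ : Representation ℝ P W) (x : lieSub dG dP P) :
    ∃ a : LieAlg dP P, lieIncl dG dP P a = x ∧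
      ∀ w, infAct ρ x w = mvfderiv (𝓡 dP) (fun h : P => ρ h w) 1 a :=
  ⟨_, Classical.choose_spec (LinearMap.mem_range.1 x.2), fun _ => rfl⟩

theorem PrincipalBundle.mdifferentiableAt_orbit [IsManifold (𝓡 dP) ∞ P]
    (Γ : PrincipalBundle dP dT dM P T M) (u : T) (h : P) :
    MDifferentiableAt (𝓡 dP) (𝓡 dT) (fun h : P => u <• h) h :=
  (Γ.contMDiff_action.comp (contMDiff_const.prodMk contMDiff_id)).mdifferentiableAt (by simp)

theorem PrincipalBundle.mdifferentiableAt_translation [IsManifold (𝓡 dT) ∞ T]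
    (Γ : PrincipalBundle dP dT dM P T M) (h : P) (u : T) :
    MDifferentiableAt (𝓡 dT) (𝓡 dT) (fun u : T => u <• h) u :=
  (Γ.contMDiff_action.comp (contMDiff_id.prodMk contMDiff_const)).mdifferentiableAt (by simp)

variable [LieGroup (𝓡 dG) ∞ G] [IsManifold (𝓡 dT) ∞ T]

namespace CartanGeometry

variable (Γ : CartanGeometry dG dP dT dM P T M)

theorem formInv_form (u : T) (ξ : TangentSpace (𝓡 dT) u) : Γ.formInv u (Γ.form u ξ) = ξ :=
  (LinearEquiv.ofBijective (Γ.form u).toLinearMap (Γ.bijective_form u)).symm_apply_apply ξ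

theorem form_formInv (u : T) (x : LieAlg dG G) : Γ.form u (Γ.formInv u x) = x :=
  (LinearEquiv.ofBijective (Γ.form u).toLinearMap (Γ.bijective_form u)).apply_symm_apply x

variable {F : Type*} [NormedAddCommGroup F] [NormedSpace ℝ F]

theorem D_form (f : T → F) (u : T) (ξ : TangentSpace (𝓡 dT) u) :
    Γ.D f u (Γ.form u ξ) = mvfderiv (𝓡 dT) f u ξ :=
  congrArg (mvfderiv (𝓡 dT) f u) (Γ.formInv_form u ξ)

theorem D_clm_comp {F' : Type*} [NormedAddCommGroup F'] [NormedSpace ℝ F'] (L : F →L[ℝ] F')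
    {f : T → F} {u : T} (hf : MDifferentiableAt (𝓡 dT) 𝓘(ℝ, F) f u) (x : LieAlg dG G) :
    Γ.D (fun v => L (f v)) u x = L (Γ.D f u x) :=
  mvfderiv_clm_comp L hf _

/-- The fundamental derivative in the direction of an element of `𝔭` is the derivative along the
orbits of the principal action. -/
theorem D_lieIncl [IsManifold (𝓡 dP) ∞ P] {f : T → F} {u : T}
    (hf : MDifferentiableAt (𝓡 dT) 𝓘(ℝ, F) f u) (a : LieAlg dP P) :
    Γ.D f u (lieIncl dG dP P a) = mvfderiv (𝓡 dP) (fun h : P => f (u <• h)) 1 a := by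
  have hu : u <• (1 : P) = u := one_smul _ _
  have key : ∀ v : T, u <• (1 : P) = v → Γ.form v (mfderiv (𝓡 dP) (𝓡 dT) (fun h : P => u <• h) 1 a :
      EuclideanSpace ℝ (Fin dT)) = lieIncl dG dP P a := by
    rintro _ rfl
    exact Γ.form_fundamental u a
  rw [← key u hu]
  exact (Γ.D_form f u _).trans
    (mvfderiv_comp_apply_of_eq hf (Γ.mdifferentiableAt_orbit u 1) hu a).symm

/-- The Cartan connection in the preferred chart at `u`. -/
noncomputable def chartForm (u : T) (y : EuclideanSpace ℝ (Fin dT)) :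
    EuclideanSpace ℝ (Fin dT) →L[ℝ] LieAlg dG G :=
  (Γ.form ((extChartAt (𝓡 dT) u).symm y)).comp (chartFrame u y)

theorem contDiffOn_chartForm (u : T) :
    ContDiffOn ℝ ∞ (Γ.chartForm u) (extChartAt (𝓡 dT) u).target := by
  rw [contDiffOn_clm_apply]
  intro v
  rw [← contMDiffOn_iff_contDiffOn]
  have h1 := (contMDiffOn_extChartAt_symm (I := 𝓡 dT) (n := ∞) u).contMDiffOn_tangentMapWithin
    (m := ∞) (by simp) (isOpen_extChartAt_target u).uniqueMDiffOn
  have h2 : ContMDiffOn 𝓘(ℝ, EuclideanSpace ℝ (Fin dT))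
      𝓘(ℝ, EuclideanSpace ℝ (Fin dT)).tangent ∞
      (fun y => (⟨y, v⟩ : TangentBundle 𝓘(ℝ, EuclideanSpace ℝ (Fin dT))
        (EuclideanSpace ℝ (Fin dT)))) (extChartAt (𝓡 dT) u).target :=
    contMDiffOn_vectorSpace_iff_contDiffOn.2 contDiffOn_const
  exact Γ.contMDiff_form.comp_contMDiffOn (h1.comp h2 fun y hy => hy)

/-- The fundamental derivative of a smooth function is differentiable. -/
theorem mdifferentiableAt_D {f : T → F} (hf : ContMDiff (𝓡 dT) 𝓘(ℝ, F) ∞ f) (u : T) :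
    MDifferentiableAt (𝓡 dT) 𝓘(ℝ, LieAlg dG G →L[ℝ] F) (Γ.D f) u := by
  have : IsManifold (𝓡 dT) 1 T := IsManifold.of_le (n := ∞) ENat.LEInfty.out
  set φ := extChartAt (𝓡 dT) u
  have ht : φ.target ∈ nhds (φ u) := extChartAt_target_mem_nhds _
  have hs : ContMDiffOn 𝓘(ℝ, EuclideanSpace ℝ (Fin dT)) (𝓡 dT) ∞ φ.symm φ.target :=
    contMDiffOn_extChartAt_symm u
  have hfφ : ContDiffOn ℝ ∞ (f ∘ φ.symm) φ.target :=
    contMDiffOn_iff_contDiffOn.1 (hf.comp_contMDiffOn hs)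
  have hbij : ∀ y ∈ φ.target, ∃ e : EuclideanSpace ℝ (Fin dT) ≃L[ℝ] LieAlg dG G,
      (e : EuclideanSpace ℝ (Fin dT) →L[ℝ] LieAlg dG G) = Γ.chartForm u y := fun y hy => by
    have hb : Function.Bijective (Γ.chartForm u y) :=
      (Γ.bijective_form _).comp (bijective_chartFrame u hy)
    exact ⟨(LinearEquiv.ofBijective (Γ.chartForm u y).toLinearMap hb).toContinuousLinearEquiv, rfl⟩
  -- In the chart, Df is the ordinary derivative composed with the inverse of the coordinate
  -- expression of ω. Inversion of invertible operators is smooth, so differentiability follows.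
  have hD : ∀ y ∈ φ.target, Γ.D f (φ.symm y) =
      (fderiv ℝ (f ∘ φ.symm) y).comp (Γ.chartForm u y).inverse := fun y hy => by
    obtain ⟨e, he⟩ := hbij y hy
    have hc : (Γ.D f (φ.symm y)).comp (Γ.chartForm u y) = fderiv ℝ (f ∘ φ.symm) y := by
      ext1 v
      refine (Γ.D_form f (φ.symm y) (chartFrame u y v)).trans ?_
      have h1 := mfderivWithin_of_isOpen (I := 𝓘(ℝ, EuclideanSpace ℝ (Fin dT))) (I' := 𝓡 dT)
        (f := φ.symm) (isOpen_extChartAt_target u) hy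
      have h2 := mfderiv_comp_apply (I := 𝓘(ℝ, EuclideanSpace ℝ (Fin dT))) (I' := 𝓡 dT)
        (I'' := 𝓘(ℝ, F)) (g := f) (f := φ.symm) y (hf.mdifferentiableAt (by simp))
        ((hs.contMDiffAt (extChartAt_target_mem_nhds' hy)).mdifferentiableAt (by simp)) v
      rw [mfderiv_eq_fderiv] at h2
      rw [chartFrame, h1]
      exact h2.symm
    rw [← hc, ← he, ContinuousLinearMap.inverse_equiv]
    ext1 x
    simp
  obtain ⟨e, he⟩ := hbij (φ u) (mem_extChartAt_target u)
  have h1 : DifferentiableAt ℝ (fderiv ℝ (f ∘ φ.symm)) (φ u) :=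
    ((hfφ.contDiffAt ht).fderiv_right (m := 1)
      (by rw [one_add_one_eq_two]; exact ENat.LEInfty.out)).differentiableAt (by simp)
  have h2 : DifferentiableAt ℝ (fun y => (Γ.chartForm u y).inverse) (φ u) := by
    have h3 : DifferentiableAt ℝ ContinuousLinearMap.inverse (Γ.chartForm u (φ u)) := by
      rw [← he]
      exact (contDiffAt_map_inverse (n := 1) e).differentiableAt (by simp)
    exact h3.comp (φ u) (((Γ.contDiffOn_chartForm u).contDiffAt ht).differentiableAt (by simp))
  have h4 : DifferentiableAt ℝ (Γ.D f ∘ φ.symm) (φ u) := by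
    refine (h1.clm_comp h2).congr_of_eventuallyEq ?_
    filter_upwards [ht] with y hy using hD y hy
  exact (mvfderiv_of_hasFDerivAt h4.hasFDerivAt).1

section Equivariant

variable {W : Type*} [NormedAddCommGroup W] [NormedSpace ℝ W] {ρ : Representation ℝ P W}
  [FiniteDimensional ℝ W]

/-- The fundamental derivative of an equivariant function is equivariant. -/
theorem D_equivariant {σ : T → W}
    (hσ : ContMDiff (𝓡 dT) 𝓘(ℝ, W) ∞ σ)
    (hσ' : ∀ u, ∀ h : P, σ (u <• h) = ρ h⁻¹ (σ u)) (u : T) (h : P) (y : LieAlg dG G) :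
    ρ h (Γ.D σ (u <• h) y) = Γ.D σ u (Ad dG G (h : G) y) := by
  have hd : ∀ v, MDifferentiableAt (𝓡 dT) 𝓘(ℝ, W) σ v := fun v => hσ.mdifferentiableAt (by simp)
  -- Chosen so that right translation by h carries ξ to the vector at u h on which ω takes the value
  -- y.
  set ξ := Γ.formInv u (Ad dG G (h : G) y) with hξ
  have h1 := Γ.form_equivariant h u ξ
  rw [hξ, form_formInv, ← Module.End.mul_apply, ← map_mul, inv_mul_cancel, map_one,
    Module.End.one_apply] at h1
  conv_lhs => rw [← h1]
  have h2 := mvfderiv_comp_apply_of_eq (hd (u <• h)) (Γ.mdifferentiableAt_translation h u) rfl ξ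
  rw [D_form, ← h2]
  have h3 : (fun v : T => σ (v <• h)) = fun v => (ρ h⁻¹).toContinuousLinearMap (σ v) :=
    funext fun v => hσ' v h
  rw [h3, mvfderiv_clm_comp _ (hd u)]
  change ρ h (ρ h⁻¹ _) = _
  rw [← Module.End.mul_apply, ← map_mul, mul_inv_cancel, map_one]
  rfl

variable [LieGroup (𝓡 dP) ∞ P]

/-- By equivariance h ↦ ρ(h) σ(u h) is constant on P. Its derivative at 1, split by the Leibniz
rule, is z•σ(u) + D_zσ(u). -/
theorem D_of_mem_lieSub (hρ : IsSmoothRep (dP := dP) ρ) {σ : T → W}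
    (hσ : ContMDiff (𝓡 dT) 𝓘(ℝ, W) ∞ σ)
    (hσ' : ∀ u, ∀ h : P, σ (u <• h) = ρ h⁻¹ (σ u)) (u : T) (z : lieSub dG dP P) :
    Γ.D σ u z = -infAct ρ z (σ u) := by
  have : IsManifold (𝓡 dP) ∞ P := ContMDiffMul.toIsManifold
  have : IsManifold (𝓡 dP) 1 P := IsManifold.of_le (n := ∞) ENat.LEInfty.out
  have hd : ∀ v, MDifferentiableAt (𝓡 dT) 𝓘(ℝ, W) σ v := fun v => hσ.mdifferentiableAt (by simp)
  obtain ⟨a, ha, hz⟩ := exists_infAct ρ z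
  rw [← ha, D_lieIncl Γ (hd u), hz]
  have h1 := hρ.mvfderiv_apply (w := fun h => σ (u <• h))
    (MDifferentiableAt.comp_of_eq _ (hd u) (Γ.mdifferentiableAt_orbit u 1) (one_smul _ _)) a
  have h2 : (fun h : P => ρ h (σ (u <• h))) = fun _ => σ u := funext fun h => by
    rw [hσ', ← Module.End.mul_apply, ← map_mul, mul_inv_cancel, map_one]
    rfl
  rw [h2, mvfderiv_const, show u <• (1 : P) = u from one_smul _ _] at h1
  exact (neg_eq_of_add_eq_zero_right h1.symm).symm

/-- The second fundamental derivative, when the second argument is in `𝔭`. -/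
theorem D_D_apply_mem_lieSub (hρ : IsSmoothRep (dP := dP) ρ) {σ : T → W}
    (hσ : ContMDiff (𝓡 dT) 𝓘(ℝ, W) ∞ σ)
    (hσ' : ∀ u, ∀ h : P, σ (u <• h) = ρ h⁻¹ (σ u)) (u : T) (x : LieAlg dG G)
    (z : lieSub dG dP P) :
    Γ.D (Γ.D σ) u x z = -infAct ρ z (Γ.D σ u x) := by
  have hd : ∀ v, MDifferentiableAt (𝓡 dT) 𝓘(ℝ, W) σ v := fun v => hσ.mdifferentiableAt (by simp)
  obtain ⟨a, ha, hz⟩ := exists_infAct ρ z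
  obtain ⟨L, hL⟩ := hρ.exists_clm a
  have h1 := Γ.D_clm_comp (ContinuousLinearMap.apply ℝ W (z : LieAlg dG G))
    (Γ.mdifferentiableAt_D hσ u) x
  -- The first order identity holds at every point of the total space, with z fixed, so it may be
  -- differentiated in the direction x.
  have h2 : (fun v => ContinuousLinearMap.apply ℝ W (z : LieAlg dG G) (Γ.D σ v)) =
      fun v => (-L) (σ v) := funext fun v => by
    change Γ.D σ v z = -L (σ v)
    rw [Γ.D_of_mem_lieSub hρ hσ hσ', hz, hL]
  rw [h2, Γ.D_clm_comp _ (hd u)] at h1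
  rw [hz, hL]
  exact h1.symm

/-- The second fundamental derivative, when the first argument is in `𝔭`. -/
theorem D_D_mem_lieSub_apply (hP : ContMDiff (𝓡 dP) (𝓡 dG) ∞ (Subtype.val : P → G))
    (hρ : IsSmoothRep (dP := dP) ρ) {σ : T → W}
    (hσ : ContMDiff (𝓡 dT) 𝓘(ℝ, W) ∞ σ)
    (hσ' : ∀ u, ∀ h : P, σ (u <• h) = ρ h⁻¹ (σ u)) (u : T) (z : lieSub dG dP P)
    (y : LieAlg dG G) :
    Γ.D (Γ.D σ) u z y = -infAct ρ z (Γ.D σ u y) + Γ.D σ u ⁅(z : LieAlg dG G), y⁆ := by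
  have : IsManifold (𝓡 dP) ∞ P := ContMDiffMul.toIsManifold
  have : IsManifold (𝓡 dP) 1 P := IsManifold.of_le (n := ∞) ENat.LEInfty.out
  obtain ⟨a, ha, hz⟩ := exists_infAct ρ z
  have hDy : MDifferentiableAt (𝓡 dT) 𝓘(ℝ, W) (fun v => Γ.D σ v y) u :=
    (mvfderiv_comp_hasFDerivAt (ContinuousLinearMap.apply ℝ W y).hasFDerivAt
      (Γ.mdifferentiableAt_D hσ u)).1
  have h1 : Γ.D (Γ.D σ) u z y = mvfderiv (𝓡 dP) (fun h : P => Γ.D σ (u <• h) y) 1 a := by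
    rw [← D_lieIncl Γ hDy, ha]
    exact (Γ.D_clm_comp (ContinuousLinearMap.apply ℝ W y) (Γ.mdifferentiableAt_D hσ u) z).symm
  have h2 := hρ.mvfderiv_apply (w := fun h => Γ.D σ (u <• h) y)
    (MDifferentiableAt.comp_of_eq _ hDy (Γ.mdifferentiableAt_orbit u 1) (one_smul _ _)) a
  -- Both sides are differentiated at h = 1: the left by the Leibniz rule, the right through Ad,
  -- which produces the bracket term.
  have h3 : (fun h : P => ρ h (Γ.D σ (u <• h) y)) = fun h : P => Γ.D σ u (Ad dG G (h : G) y) :=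
    funext fun h => Γ.D_equivariant hσ hσ' u h y
  have hv : MDifferentiableAt (𝓡 dP) (𝓡 dG) (Subtype.val : P → G) 1 :=
    hP.mdifferentiableAt (by simp)
  have hAd : MDifferentiableAt (𝓡 dP) 𝓘(ℝ, LieAlg dG G) (fun h : P => Ad dG G (h : G) y) 1 :=
    MDifferentiableAt.comp_of_eq _ (mvfderiv_Ad y).1 hv rfl
  rw [h3, mvfderiv_clm_comp _ hAd, mvfderiv_comp_apply_of_eq (mvfderiv_Ad y).1 hv rfl] at h2
  have h4 : mvfderiv (𝓡 dG) (fun g : G => Ad dG G g y) 1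
      (mfderiv (𝓡 dP) (𝓡 dG) (Subtype.val : P → G) 1 a) = ⁅(z : LieAlg dG G), y⁆ :=
    ((mvfderiv_Ad y).2 _).trans (by rw [← ha]; rfl)
  rw [show u <• (1 : P) = u from one_smul _ _] at h2
  rw [h1, hz, ← h4]
  refine eq_neg_add_of_add_eq ?_
  exact h2.symm

end Equivariant

end CartanGeometry

end Geometry

end ParabolicGeometry

/-! ### The Casimir formula in an adapted frame -/

open ParabolicGeometry in
theorem proposition3p3
    {dG dP dT dM : ℕ}
    -- a semisimple Lie group `G`
    {G : Type*} [TopologicalSpace G] [ChartedSpace (EuclideanSpace ℝ (Fin dG)) G] [Group G]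
    [LieGroup (𝓡 dG) ∞ G] [LieAlgebra.IsSemisimple ℝ (LieAlg dG G)]
    -- a parabolic subgroup `P` of `G`, and the grading of the Lie algebra of `G` defining it
    {P : Subgroup G} [ChartedSpace (EuclideanSpace ℝ (Fin dP)) P] [LieGroup (𝓡 dP) ∞ P]
    (gr : ℤ → Submodule ℝ (LieAlg dG G)) [GradedLieAlgebra gr]
    (hP : IsParabolicSubgroup (dP := dP) P gr)
    -- a parabolic geometry of type `(G, P)` on `M` with total space `T`
    {T : Type*} [TopologicalSpace T] [ChartedSpace (EuclideanSpace ℝ (Fin dT)) T]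
    [IsManifold (𝓡 dT) ∞ T] [MulAction Pᵐᵒᵖ T]
    {M : Type*} [TopologicalSpace M] [ChartedSpace (EuclideanSpace ℝ (Fin dM)) M]
    [IsManifold (𝓡 dM) ∞ M]
    (Γ : CartanGeometry dG dP dT dM P T M)
    -- a finite dimensional representation `W` of `P`
    {W : Type*} [NormedAddCommGroup W] [NormedSpace ℝ W] [FiniteDimensional ℝ W]
    (ρ : Representation ℝ P W) (hρ : IsSmoothRep (dP := dP) ρ)
    -- an adapted frame over an open subset `U`, and its dual frame
    {U : Set M} (hU : IsOpen U) {ι κ : Type*} [Fintype ι] [DecidableEq ι] [Fintype κ] [DecidableEq κ]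
    (X : ι → Γ.AdjointSection U) (A : κ → Γ.AdjointSection U) (Z : ι → Γ.AdjointSection U)
    (hXAZ : Γ.IsAdaptedFrame gr U X A Z)
    (A' : κ → Γ.AdjointSection U)
    (hdual : ∀ u ∈ Γ.proj ⁻¹' U, IsKillingDual
      (Sum.elim (fun i => X i u) (Sum.elim (fun r => A r u) (fun i => Z i u)))
      (Sum.elim (fun i => Z i u) (Sum.elim (fun r => A' r u) (fun i => X i u))))
    -- a section of the natural bundle
    (σ : Γ.Section ρ Set.univ) :
    ∃ (hA' : ∀ r, ∀ u ∈ Γ.proj ⁻¹' U, A' r u ∈ lieSub dG dP P)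
      (hZX : ∀ u ∈ Γ.proj ⁻¹' U, ∑ i, ⁅Z i u, X i u⁆ ∈ lieSub dG dP P),
      ∀ u, ∀ hu : u ∈ Γ.proj ⁻¹' U,
        Γ.curvedCasimir σ u =
          -(2 : ℝ) • ∑ i, infAct ρ ⟨Z i u, hP.filt_one_le (hXAZ.Z_mem i u hu)⟩ (Γ.D σ u (X i u))
          - infAct ρ ⟨∑ i, ⁅Z i u, X i u⁆, hZX u hu⟩ (σ u)
          + ∑ r, infAct ρ ⟨A' r u, hA' r u hu⟩ (infAct ρ ⟨A r u, hXAZ.A_mem r u hu⟩ (σ u)) := by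
  have hp : ∀ x, x ∈ lieSub dG dP P ↔ x ∈ filt gr 0 := fun x => by rw [hP.lieSub_eq]
  have hA : ∀ u ∈ Γ.proj ⁻¹' U, ∀ r, A r u ∈ filt gr 0 := fun u hu r =>
    (hp _).1 (hXAZ.A_mem r u hu)
  have hA' : ∀ r, ∀ u ∈ Γ.proj ⁻¹' U, A' r u ∈ lieSub dG dP P := fun r u hu =>
    (hp _).2 (dual_mem_filt_zero gr (hXAZ.linearIndependent u hu) (hXAZ.span_eq_top u hu)
      (fun i => hXAZ.Z_mem i u hu) (hA u hu) (hdual u hu) r)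
  have hZX : ∀ u ∈ Γ.proj ⁻¹' U, ∑ i, ⁅Z i u, X i u⁆ ∈ lieSub dG dP P := fun u hu =>
    (hp _).2 (sum_lie_mem_filt_zero gr (hXAZ.linearIndependent u hu) (hXAZ.span_eq_top u hu)
      (fun i => hXAZ.Z_mem i u hu) (hA u hu) (hdual u hu))
  have hσ : ContMDiff (𝓡 dT) 𝓘(ℝ, W) ∞ σ := contMDiffOn_univ.1 σ.contMDiffOn
  have hσ' : ∀ u, ∀ h : P, σ (u <• h) = ρ h⁻¹ (σ u) := fun u => σ.equivariant u trivial
  refine ⟨hA', hZX, fun u hu => ?_⟩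
  set e := Module.Basis.mk (hXAZ.linearIndependent u hu) (hXAZ.span_eq_top u hu).ge
  have he : IsKillingDual e
      (Sum.elim (fun i => Z i u) (Sum.elim (fun r => A' r u) (fun i => X i u))) := by
    rw [Module.Basis.coe_mk]
    exact hdual u hu
  have h1 : ∀ i, Γ.D (Γ.D σ) u (X i u) (Z i u) =
      -infAct ρ ⟨Z i u, hP.filt_one_le (hXAZ.Z_mem i u hu)⟩ (Γ.D σ u (X i u)) := fun i =>
    Γ.D_D_apply_mem_lieSub hρ hσ hσ' u _ ⟨Z i u, hP.filt_one_le (hXAZ.Z_mem i u hu)⟩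
  have h2 : ∀ r, Γ.D (Γ.D σ) u (A r u) (A' r u) =
      infAct ρ ⟨A' r u, hA' r u hu⟩ (infAct ρ ⟨A r u, hXAZ.A_mem r u hu⟩ (σ u)) := fun r => by
    have h := Γ.D_D_apply_mem_lieSub hρ hσ hσ' u (A r u) ⟨A' r u, hA' r u hu⟩
    have h' := Γ.D_of_mem_lieSub hρ hσ hσ' u ⟨A r u, hXAZ.A_mem r u hu⟩
    -- Linearity of the action of A^r is needed to cancel the two minus signs; `infAct` is a bare
    -- function, so a linear map representing it is used.
    obtain ⟨a, -, ha⟩ := exists_infAct ρ ⟨A' r u, hA' r u hu⟩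
    obtain ⟨L, hL⟩ := hρ.exists_clm a
    refine h.trans ?_
    rw [ha, ha, hL, hL]
    exact (congrArg (fun w => -L w) h').trans (by simp)
  have h3 : ∀ i, Γ.D (Γ.D σ) u (Z i u) (X i u) =
      -infAct ρ ⟨Z i u, hP.filt_one_le (hXAZ.Z_mem i u hu)⟩ (Γ.D σ u (X i u)) +
        Γ.D σ u ⁅Z i u, X i u⁆ := fun i =>
    Γ.D_D_mem_lieSub_apply hP.contMDiff_val hρ hσ hσ' u
      ⟨Z i u, hP.filt_one_le (hXAZ.Z_mem i u hu)⟩ _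
  -- Applied to the whole sum, since the single brackets [Z^i, X_i] need not lie in 𝔭.
  have h4 := Γ.D_of_mem_lieSub hρ hσ hσ' u ⟨∑ i, ⁅Z i u, X i u⁆, hZX u hu⟩
  rw [map_sum] at h4
  rw [CartanGeometry.curvedCasimir, killingContraction_eq _ e _ he, Module.Basis.coe_mk,
    Fintype.sum_sum_type, Fintype.sum_sum_type]
  change ∑ i, Γ.D (Γ.D σ) u (X i u) (Z i u) + (∑ r, Γ.D (Γ.D σ) u (A r u) (A' r u) +
    ∑ i, Γ.D (Γ.D σ) u (Z i u) (X i u)) = _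
  rw [Finset.sum_congr rfl fun i _ => h1 i, Finset.sum_congr rfl fun r _ => h2 r,
    Finset.sum_congr rfl fun i _ => h3 i, Finset.sum_add_distrib, h4, Finset.sum_neg_distrib]
  module
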